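/- Let $\boldsymbol{ax+b}=\{(a,b):a\in\mathbb R^+,\ b\in\mathbb R\}$, where $\mathbb R^+=(0,\infty)$, be the group with product $(a,b)(c,d)=(ac,ad+b)$, and let $H_{\boldsymbol b}=\{(1,b):b\in\mathbb R\}$, a normal subgroup. All groups carry the discrete topology. A weight on a group $G$ is a function $\omega:G\to(0,\infty)$ with $\omega(xy)\le\omega(x)\omega(y)$ for all $x,y\in G$; it is diagonally bounded if $x\mapsto\omega(x)\omega(x^{-1})$ is bounded on $G$. Let $\ell^1(G,\omega)$ be the Banach algebra of all $f:G\to\mathbb C$ with $\|f\|_\omega=\sum_{x\in G}|f(x)|\omega(x)<\infty$, with the convolution product. A Banach algebra $A$ is weakly amenable if every continuous derivation from $A$ into its dual bimodule $A^*$ is inner. For a normal subgroup $H$ of $G$ put $\hat\omega([x])=\inf_{z\in[x]}\omega(z)$ for $[x]\in G/H$. (1) Let $w$ be a weight on the multiplicative group $\mathbb R^+$ that is not diagonally bounded and such that $\ell^1(\mathbb R^+,w)$ is weakly amenable. Define $\omega$ on $\boldsymbol{ax+b}$ by $\omega(a,b)=w(a)$. Then $\omega$ is a weight on $\boldsymbol{ax+b}$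 that is not diagonally bounded; its restriction to $H_{\boldsymbol b}$ is constant, equal to $w(1)$, and is a weight; $\hat\omega([(a,b)])=w(a)$ for all $(a,b)$, and $\hat\omega$ is a weight on $(\boldsymbol{ax+b})/H_{\boldsymbol b}$. Both $\ell^1(H_{\boldsymbol b},\omega|_{H_{\boldsymbol b}})$ and $\ell^1((\boldsymbol{ax+b})/H_{\boldsymbol b},\hat\omega)$ are weakly amenable, but $\ell^1(\boldsymbol{ax+b},\omega)$ is not weakly amenable. (2) For every $0<\alpha<1/2$, the function $w(a)=(1+|\ln a|)^\alpha$ is a weight on $\mathbb R^+$ that is not diagonally bounded and such that $\ell^1(\mathbb R^+,w)$ is weakly amenable. -/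

import Mathlib

noncomputable section

/-- A weight on a discrete group: a positive submultiplicative function. (Over a discrete group
local boundedness, measurability and continuity are automatic.) -/
structure IsWeight {G : Type*} [Group G] (ω : G → ℝ) : Prop where
  pos : ∀ x, 0 < ω x
  mul_le : ∀ x y, ω (x * y) ≤ ω x * ω y

/-- `ω` is diagonally bounded if `x ↦ ω x * ω x⁻¹` is bounded. -/
def DiagonallyBounded {G : Type*} [Group G] (ω : G → ℝ) : Prop :=
  BddAbove (Set.range fun x => ω x * ω x⁻¹)

/-- The functions `f : G → ℂ` with `∑ |f x| ω x < ∞`. -/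
def beurlingSubmodule {G : Type*} [Group G] {ω : G → ℝ} (hω : IsWeight ω) :
    Submodule ℂ (G → ℂ) where
  carrier := {f | Summable fun x => ‖f x‖ * ω x}
  zero_mem' := by simp [summable_zero]
  add_mem' {f g} hf hg := by
    refine Summable.of_nonneg_of_le (fun x => by have := (hω.pos x).le; positivity) (fun x => ?_)
      (Summable.add hf hg)
    rw [← add_mul]
    exact mul_le_mul_of_nonneg_right (norm_add_le _ _) (hω.pos x).le
  smul_mem' c f hf := by
    have h := Summable.mul_left ‖c‖ (show Summable fun x => ‖f x‖ * ω x from hf)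
    simpa [mul_assoc] using h

/-- The Beurling algebra `ℓ¹(G, ω)` of a discrete group `G`, with the norm `∑ |f x| ω x` and the
convolution product `(f * g) x = ∑ y, f y g (y⁻¹ x)`. -/
def Beurling {G : Type*} [Group G] {ω : G → ℝ} (hω : IsWeight ω) : Type _ :=
  beurlingSubmodule hω

namespace Beurling

variable {G : Type*} [Group G] {ω : G → ℝ} {hω : IsWeight ω}

instance : AddCommGroup (Beurling hω) := inferInstanceAs (AddCommGroup (beurlingSubmodule hω))

instance : Module ℂ (Beurling hω) := inferInstanceAs (Module ℂ (beurlingSubmodule hω))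

instance : CoeFun (Beurling hω) fun _ => G → ℂ := ⟨fun f => f.1⟩

theorem ext' {f g : Beurling hω} (h : ∀ x, f x = g x) : f = g := Subtype.ext (funext h)

theorem add_apply (f g : Beurling hω) (x : G) : (f + g) x = f x + g x := rfl

theorem zero_apply (x : G) : (0 : Beurling hω) x = 0 := rfl

theorem neg_apply (f : Beurling hω) (x : G) : (-f) x = -f x := rfl

theorem smul_apply (c : ℂ) (f : Beurling hω) (x : G) : (c • f) x = c * f x := rfl

theorem summable (f : Beurling hω) : Summable fun x => ‖f x‖ * ω x := f.2

theorem term_nonneg (hω : IsWeight ω) (f : G → ℂ) (x : G) : 0 ≤ ‖f x‖ * ω x :=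
  mul_nonneg (norm_nonneg _) (hω.pos x).le

instance : Norm (Beurling hω) := ⟨fun f => ∑' x, ‖f x‖ * ω x⟩

theorem norm_def (f : Beurling hω) : ‖f‖ = ∑' x, ‖f x‖ * ω x := rfl

theorem term_le_norm (f : Beurling hω) (x : G) : ‖f x‖ * ω x ≤ ‖f‖ :=
  f.summable.le_tsum x fun y _ => term_nonneg hω f y

instance : NormedAddCommGroup (Beurling hω) :=
  AddGroupNorm.toNormedAddCommGroup
    { toFun := fun f => ‖f‖
      map_zero' := by simp [norm_def, zero_apply]
      add_le' := fun f g => by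
        rw [norm_def, norm_def, norm_def, ← f.summable.tsum_add g.summable]
        refine (f + g).summable.tsum_le_tsum (fun x => ?_) (f.summable.add g.summable)
        rw [← add_mul]
        exact mul_le_mul_of_nonneg_right (norm_add_le _ _) (hω.pos x).le
      neg' := fun f => by simp [norm_def, neg_apply]
      eq_zero_of_map_eq_zero' := fun f hf => ext' fun x => by
        have h := term_le_norm f x
        have hf' : ‖f‖ = 0 := hf
        rw [hf'] at h
        have h0 := hω.pos x
        have : ‖f x‖ = 0 := le_antisymm (by nlinarith [norm_nonneg (f x)]) (norm_nonneg _)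
        simpa [zero_apply] using this }

instance : NormedSpace ℂ (Beurling hω) where
  norm_smul_le c f := by
    rw [norm_def, norm_def, ← tsum_mul_left]
    simp [smul_apply, mul_assoc]

/-- Multiplication by `ω` identifies `ℓ¹(G, ω)` isometrically with `ℓ¹(G)`. -/
def toL1 (hω : IsWeight ω) : Beurling hω ≃ₗᵢ[ℂ] lp (fun _ : G => ℂ) 1 where
  toFun f := ⟨fun x => f x * (ω x : ℂ), memℓp_gen (by
    simpa [abs_of_pos (hω.pos _)] using f.summable)⟩
  invFun u := ⟨fun x => u x / (ω x : ℂ), by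
    have h := u.2.summable (by simp)
    refine h.congr fun x => ?_
    have hx := hω.pos x
    simp [abs_of_pos hx, hx.ne']⟩
  map_add' f g := by
    ext x
    exact add_mul _ _ _
  map_smul' c f := by
    ext x
    exact mul_assoc _ _ _
  left_inv f := ext' fun x => by
    have hx : (ω x : ℂ) ≠ 0 := by exact_mod_cast (hω.pos x).ne'
    exact mul_div_cancel_right₀ _ hx
  right_inv u := by
    ext x
    have hx : (ω x : ℂ) ≠ 0 := by exact_mod_cast (hω.pos x).ne'
    exact div_mul_cancel₀ _ hx
  norm_map' f := by
    rw [lp.norm_eq_tsum_rpow (by simp), norm_def]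
    simp only [ENNReal.toReal_one, Real.rpow_one, div_one]
    refine tsum_congr fun x => (norm_mul (f x) (ω x : ℂ)).trans ?_
    rw [Complex.norm_real, Real.norm_of_nonneg (hω.pos x).le]

instance : CompleteSpace (Beurling hω) :=
  (completeSpace_congr (e := (toL1 hω).toEquiv) (toL1 hω).isometry.isUniformEmbedding).mpr
    inferInstance

/-- The change of variables `(x, y) ↦ (y, y⁻¹ x)`. -/
def shear (G : Type*) [Group G] : G × G ≃ G × G where
  toFun p := (p.2, p.2⁻¹ * p.1)
  invFun p := (p.1 * p.2, p.1)
  left_inv p := by simp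
  right_inv p := by simp

theorem summable_shear (f g : Beurling hω) :
    Summable fun p : G × G => ‖f p.2‖ * ω p.2 * (‖g (p.2⁻¹ * p.1)‖ * ω (p.2⁻¹ * p.1)) :=
  (shear G).summable_iff.mpr (f.summable.mul_of_nonneg g.summable
    (fun x => term_nonneg hω f x) (fun x => term_nonneg hω g x))

theorem conv_term_le (f g : Beurling hω) (x y : G) :
    ‖f y * g (y⁻¹ * x)‖ * ω x ≤ ‖f y‖ * ω y * (‖g (y⁻¹ * x)‖ * ω (y⁻¹ * x)) := by
  have h := hω.mul_le y (y⁻¹ * x)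
  rw [mul_inv_cancel_left] at h
  rw [norm_mul]
  calc _ ≤ ‖f y‖ * ‖g (y⁻¹ * x)‖ * (ω y * ω (y⁻¹ * x)) := by gcongr
    _ = _ := by ring

theorem summable_conv_prod (f g : Beurling hω) :
    Summable fun p : G × G => ‖f p.2 * g (p.2⁻¹ * p.1)‖ * ω p.1 :=
  Summable.of_nonneg_of_le (fun _ => mul_nonneg (norm_nonneg _) (hω.pos _).le)
    (fun p => conv_term_le f g p.1 p.2) (summable_shear f g)

theorem summable_norm_conv (f g : Beurling hω) (x : G) :
    Summable fun y => ‖f y * g (y⁻¹ * x)‖ :=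
  (summable_mul_right_iff (hω.pos x).ne').mp ((summable_conv_prod f g).prod_factor x)

theorem summable_conv (f g : Beurling hω) (x : G) : Summable fun y => f y * g (y⁻¹ * x) :=
  (summable_norm_conv f g x).of_norm

theorem norm_conv_le (f g : Beurling hω) (x : G) :
    ‖∑' y, f y * g (y⁻¹ * x)‖ * ω x ≤ ∑' y, ‖f y * g (y⁻¹ * x)‖ * ω x := by
  rw [tsum_mul_right]
  exact mul_le_mul_of_nonneg_right (norm_tsum_le_tsum_norm (summable_norm_conv f g x))
    (hω.pos x).le

theorem conv_mem (f g : Beurling hω) :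
    (fun x => ∑' y, f y * g (y⁻¹ * x)) ∈ beurlingSubmodule hω :=
  Summable.of_nonneg_of_le (fun x => term_nonneg hω (fun x => ∑' y, f y * g (y⁻¹ * x)) x)
    (norm_conv_le f g) (summable_conv_prod f g).prod

instance : Mul (Beurling hω) := ⟨fun f g => ⟨fun x => ∑' y, f y * g (y⁻¹ * x), conv_mem f g⟩⟩

theorem mul_apply (f g : Beurling hω) (x : G) : (f * g) x = ∑' y, f y * g (y⁻¹ * x) := rfl

theorem mul_norm_le (f g : Beurling hω) : ‖f * g‖ ≤ ‖f‖ * ‖g‖ := by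
  have hs := summable_conv_prod f g
  calc ‖f * g‖ ≤ ∑' x, ∑' y, ‖f y * g (y⁻¹ * x)‖ * ω x :=
        (f * g).summable.tsum_le_tsum (norm_conv_le f g) hs.prod
    _ = ∑' p : G × G, ‖f p.2 * g (p.2⁻¹ * p.1)‖ * ω p.1 := hs.tsum_prod.symm
    _ ≤ ∑' p : G × G, ‖f p.2‖ * ω p.2 * (‖g (p.2⁻¹ * p.1)‖ * ω (p.2⁻¹ * p.1)) :=
        hs.tsum_le_tsum (fun p => conv_term_le f g p.1 p.2) (summable_shear f g)
    _ = ∑' p : G × G, ‖f p.1‖ * ω p.1 * (‖g p.2‖ * ω p.2) :=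
        (shear G).tsum_eq fun p : G × G => ‖f p.1‖ * ω p.1 * (‖g p.2‖ * ω p.2)
    _ = ‖f‖ * ‖g‖ := by
        rw [norm_def, norm_def]
        exact (f.summable.tsum_mul_tsum g.summable (f.summable.mul_of_nonneg g.summable
          (fun x => term_nonneg hω f x) (fun x => term_nonneg hω g x))).symm

theorem conv_assoc (f g h : Beurling hω) : f * g * h = f * (g * h) := ext' fun x => by
  have hs : Summable fun p : G × G => f p.2 * g (p.2⁻¹ * p.1) * h (p.1⁻¹ * x) := by
    refine Summable.of_norm ((summable_mul_right_iff (hω.pos x).ne').mp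
      (Summable.of_nonneg_of_le (fun _ => mul_nonneg (norm_nonneg _) (hω.pos _).le)
        (fun p => ?_) ((summable_conv_prod f g).mul_right ‖h‖)))
    have h1 := hω.mul_le p.1 (p.1⁻¹ * x)
    rw [mul_inv_cancel_left] at h1
    have h2 := term_le_norm h (p.1⁻¹ * x)
    rw [norm_mul _ (h _)]
    calc _ ≤ ‖f p.2 * g (p.2⁻¹ * p.1)‖ * ‖h (p.1⁻¹ * x)‖ * (ω p.1 * ω (p.1⁻¹ * x)) := by gcongr
      _ = ‖f p.2 * g (p.2⁻¹ * p.1)‖ * ω p.1 * (‖h (p.1⁻¹ * x)‖ * ω (p.1⁻¹ * x)) := by ring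
      _ ≤ _ := mul_le_mul_of_nonneg_left h2 (mul_nonneg (norm_nonneg _) (hω.pos _).le)
  calc (f * g * h) x = ∑' z, ∑' y, f y * g (y⁻¹ * z) * h (z⁻¹ * x) := by
        simp only [mul_apply, tsum_mul_right]
    _ = ∑' y, ∑' z, f y * g (y⁻¹ * z) * h (z⁻¹ * x) :=
        Summable.tsum_comm (f := fun y z => f y * g (y⁻¹ * z) * h (z⁻¹ * x))
          ((Equiv.prodComm G G).summable_iff.mpr hs)
    _ = ∑' y, f y * ∑' u, g u * h (u⁻¹ * (y⁻¹ * x)) := by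
        refine tsum_congr fun y => ?_
        rw [← tsum_mul_left, ← (Equiv.mulLeft y).tsum_eq]
        simp [mul_assoc]
    _ = (f * (g * h)) x := rfl

instance : NonUnitalNormedRing (Beurling hω) where
  mul_assoc := conv_assoc
  left_distrib f g h := ext' fun x => by
    simp only [add_apply, mul_apply, mul_add]
    exact (summable_conv f g x).tsum_add (summable_conv f h x)
  right_distrib f g h := ext' fun x => by
    simp only [add_apply, mul_apply, add_mul]
    exact (summable_conv f h x).tsum_add (summable_conv g h x)
  zero_mul f := ext' fun x => by simp [mul_apply, zero_apply]
  mul_zero f := ext' fun x => by simp [mul_apply, zero_apply]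
  norm_mul_le := mul_norm_le
  dist_eq := dist_eq_norm_neg_add

instance : IsScalarTower ℂ (Beurling hω) (Beurling hω) where
  smul_assoc c f g := ext' fun x => by
    simp only [smul_eq_mul, smul_apply, mul_apply, mul_assoc, tsum_mul_left]

instance : SMulCommClass ℂ (Beurling hω) (Beurling hω) where
  smul_comm c f g := ext' fun x => by
    simp only [smul_eq_mul, smul_apply, mul_apply, ← tsum_mul_left]
    exact tsum_congr fun y => by ring

end Beurling

/-- A continuous linear map `D : A → A*` is a derivation if `D (ab) = a · D b + D a · b`, where the
dual module actions are `(a · φ) x = φ (x a)` and `(φ · a) x = φ (a x)`. -/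
def IsDualDerivation {A : Type*} [NonUnitalNormedRing A] [NormedSpace ℂ A]
    (D : A →L[ℂ] (A →L[ℂ] ℂ)) : Prop :=
  ∀ a b x : A, D (a * b) x = D b (x * a) + D a (b * x)

/-- `D : A → A*` is inner if for some `φ ∈ A*`, `D a = a · φ - φ · a` for all `a`. -/
def IsInnerDualDerivation {A : Type*} [NonUnitalNormedRing A] [NormedSpace ℂ A]
    (D : A →L[ℂ] (A →L[ℂ] ℂ)) : Prop :=
  ∃ φ : A →L[ℂ] ℂ, ∀ a x : A, D a x = φ (x * a) - φ (a * x)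

/-- A complex Banach algebra `A` is weakly amenable if every continuous derivation `A → A*` is
inner. -/
def IsWeaklyAmenable (A : Type*) [NonUnitalNormedRing A] [NormedSpace ℂ A]
    [IsScalarTower ℂ A A] [SMulCommClass ℂ A A] [CompleteSpace A] : Prop :=
  ∀ D : A →L[ℂ] (A →L[ℂ] ℂ), IsDualDerivation D → IsInnerDualDerivation D

/-- The function `ω̂ ([x]) = inf {ω z : z ∈ [x]}` on the quotient group `G ⧸ H`. -/
def quotientWeight {G : Type*} [Group G] (ω : G → ℝ) (H : Subgroup G) (q : G ⧸ H) : ℝ :=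
  sInf (ω '' {z : G | (z : G ⧸ H) = q})

/-- The positive reals, a group under multiplication. -/
abbrev PosReal : Type := {a : ℝ // 0 < a}

/-- The group of affine maps `x ↦ a x + b` with `a > 0`. -/
@[ext]
structure AxB where
  a : PosReal
  b : ℝ

namespace AxB

instance : Mul AxB := ⟨fun p q => ⟨p.a * q.a, p.a * q.b + p.b⟩⟩

instance : One AxB := ⟨⟨1, 0⟩⟩

instance : Inv AxB := ⟨fun p => ⟨p.a⁻¹, -p.b / p.a⟩⟩

@[simp] theorem mul_a (p q : AxB) : (p * q).a = p.a * q.a := rfl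
@[simp] theorem mul_b (p q : AxB) : (p * q).b = p.a * q.b + p.b := rfl
@[simp] theorem one_a : (1 : AxB).a = 1 := rfl
@[simp] theorem one_b : (1 : AxB).b = 0 := rfl
@[simp] theorem inv_a (p : AxB) : p⁻¹.a = p.a⁻¹ := rfl
@[simp] theorem inv_b (p : AxB) : p⁻¹.b = -p.b / p.a := rfl

instance : Group AxB :=
  Group.ofLeftAxioms
    (fun p q r => AxB.ext (by simp [mul_assoc]) (by simp; ring))
    (fun p => AxB.ext (by simp) (by simp))
    (fun p => AxB.ext (by simp) (by
      have := p.a.2.ne'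
      simp only [mul_b, inv_a, inv_b, Positive.coe_inv, one_b]
      field_simp
      ring))

/-- The subgroup `{(1, b) : b ∈ ℝ}`. -/
def translations : Subgroup AxB where
  carrier := {p | p.a = 1}
  one_mem' := rfl
  mul_mem' {p q} hp hq := by
    simp only [Set.mem_ofPred_eq] at *
    simp [hp, hq]
  inv_mem' {p} hp := by
    simp only [Set.mem_ofPred_eq] at *
    simp [hp]

instance : translations.Normal where
  conj_mem p hp q := by
    have hp' : p.a = 1 := hp
    show (q * p * q⁻¹).a = 1
    simp [hp']

end AxB

end

/-! Write Ω(a) = w(a) w(a⁻¹). Since ω depends only on the slope, it is constant on the translations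
and on each of their cosets, so the claims about subgroup and quotient concern commutative groups.
There a derivation into the dual splits into homomorphisms φ : G → ℂ with |φ(x)| ≤ K ω(x) ω(x⁻¹),
and weak amenability means that all of these vanish (`isWeaklyAmenable_iff_of_comm`).

On the whole group, let L be log Ω(b) at (1, b) with b > 0, and 0 elsewhere. Formally D(p)(q) =
L(qp) - L(pq) is the inner derivation of L. It is bounded because qp and pq are conjugate:
conjugation multiplies b by a slope a, and this moves log Ω by at most log Ω(a) ≤ Ω(a)
(`abs_logGrowth_sub_le`). But L is unbounded on the translations, where ω is constant. A functional
ψ implementing D is bounded there, and it would force L to be bounded on the single conjugacy class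
b > 0, making w diagonally bounded. -/

noncomputable section

/-! ### Point masses, and maps determined by them -/

namespace Beurling

variable {G : Type*} [Group G] {ω : G → ℝ} {hω : IsWeight ω}

open scoped Classical in
/-- The point mass at `x`. -/
def delta (hω : IsWeight ω) (x : G) : Beurling hω :=
  ⟨Pi.single x 1, summable_of_ne_finset_zero (s := {x}) fun y hy => by
    rw [Pi.single_eq_of_ne (by simpa using hy), norm_zero, zero_mul]⟩

open scoped Classical in
theorem delta_apply (x y : G) : delta hω x y = if y = x then 1 else 0 := by
  show (Pi.single x 1 : G → ℂ) y = _
  rw [Pi.single_apply]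

theorem norm_delta (x : G) : ‖delta hω x‖ = ω x := by
  rw [norm_def, tsum_eq_single x fun y hy => by simp [delta_apply, hy]]
  simp [delta_apply]

theorem delta_mul_delta (x y : G) : delta hω x * delta hω y = delta hω (x * y) := by
  refine ext' fun z => ?_
  rw [mul_apply, tsum_eq_single x fun u hu => by simp [delta_apply, hu]]
  simp only [delta_apply, if_true, one_mul]
  classical
  exact if_congr inv_mul_eq_iff_eq_mul rfl rfl

theorem hasSum_delta (f : Beurling hω) : HasSum (fun x => f x • delta hω x) f := by
  classical
  have h := lp.hasSum_single (E := fun _ : G => ℂ) (p := 1) (by simp) (toL1 hω f)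
  have h2 := h.mapL ((toL1 hω).symm.toContinuousLinearEquiv : _ →L[ℂ] Beurling hω)
  simp only [ContinuousLinearEquiv.coe_coe, LinearIsometryEquiv.coe_toContinuousLinearEquiv,
    LinearIsometryEquiv.symm_apply_apply] at h2
  refine h2.congr_fun fun x => ?_
  refine ((toL1 hω).symm_apply_eq.mpr ?_).symm
  ext y
  show (Pi.single x (f x * (ω x : ℂ)) : G → ℂ) y = f x * delta hω x y * (ω y : ℂ)
  rw [Pi.single_apply, delta_apply]
  split_ifs with h
  · rw [h, mul_one]
  · rw [mul_zero, zero_mul]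

variable {E : Type*} [NormedAddCommGroup E] [NormedSpace ℂ E]

theorem clm_ext {S T : Beurling hω →L[ℂ] E} (h : ∀ x, S (delta hω x) = T (delta hω x)) :
    S = T := by
  ext f
  have hS := (hasSum_delta f).mapL S
  have hT := (hasSum_delta f).mapL T
  simp only [map_smul, h] at hS hT
  exact hS.unique hT

theorem norm_smul_le_of_le {v : G → E} {K : ℝ} (hv : ∀ x, ‖v x‖ ≤ K * ω x) (f : Beurling hω)
    (x : G) : ‖f x • v x‖ ≤ K * (‖f x‖ * ω x) := by
  rw [norm_smul]
  calc _ ≤ ‖f x‖ * (K * ω x) := mul_le_mul_of_nonneg_left (hv x) (norm_nonneg _)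
    _ = _ := by ring

theorem summable_smul_of_le [CompleteSpace E] {v : G → E} {K : ℝ} (hv : ∀ x, ‖v x‖ ≤ K * ω x)
    (f : Beurling hω) : Summable fun x => f x • v x :=
  Summable.of_norm_bounded (f.summable.mul_left K) (norm_smul_le_of_le hv f)

/-- The continuous linear map on `ℓ¹(G, ω)` with prescribed values `v x` at the point masses, for
`v` bounded by a multiple of `ω`. -/
def lift [CompleteSpace E] (hω : IsWeight ω) (v : G → E) (K : ℝ) (hv : ∀ x, ‖v x‖ ≤ K * ω x) :
    Beurling hω →L[ℂ] E :=
  LinearMap.mkContinuous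
    { toFun := fun f => ∑' x, f x • v x
      map_add' := fun f g => by
        rw [← (summable_smul_of_le hv f).tsum_add (summable_smul_of_le hv g)]
        simp only [add_apply, add_smul]
      map_smul' := fun c f => by
        rw [RingHom.id_apply, ← (summable_smul_of_le hv f).tsum_const_smul]
        simp only [smul_apply, mul_smul] } K fun f => by
    rw [norm_def, ← tsum_mul_left]
    exact tsum_of_norm_bounded (f.summable.mul_left K).hasSum (norm_smul_le_of_le hv f)

theorem lift_delta [CompleteSpace E] (v : G → E) (K : ℝ) (hv : ∀ x, ‖v x‖ ≤ K * ω x) (x : G) :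
    lift hω v K hv (delta hω x) = v x := by
  show ∑' y, delta hω x y • v y = v x
  rw [tsum_eq_single x fun y hy => by simp [delta_apply, hy]]
  simp [delta_apply]

theorem norm_lift_le [CompleteSpace E] {v : G → E} {K : ℝ} (hK : 0 ≤ K)
    (hv : ∀ x, ‖v x‖ ≤ K * ω x) : ‖lift hω v K hv‖ ≤ K :=
  LinearMap.mkContinuous_norm_le _ hK _

/-- A kernel bounded by a multiple of `ω x * ω y` defines a continuous map into the dual. -/
theorem exists_clm_of_kernel (hω : IsWeight ω) (k : G → G → ℂ) {K : ℝ} (hK : 0 ≤ K)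
    (hk : ∀ x y, ‖k x y‖ ≤ K * ω x * ω y) :
    ∃ D : Beurling hω →L[ℂ] (Beurling hω →L[ℂ] ℂ),
      ∀ x y, D (delta hω x) (delta hω y) = k x y :=
  ⟨lift hω (fun x => lift hω (k x) (K * ω x) (hk x)) K
      fun x => norm_lift_le (mul_nonneg hK (hω.pos x).le) (hk x),
    fun x y => by rw [lift_delta, lift_delta]⟩

theorem norm_apply_delta_le (D : Beurling hω →L[ℂ] (Beurling hω →L[ℂ] ℂ)) (x y : G) :
    ‖D (delta hω x) (delta hω y)‖ ≤ ‖D‖ * ω x * ω y := by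
  simpa only [norm_delta] using D.le_opNorm₂ (delta hω x) (delta hω y)

/-- The derivation identity may be checked on point masses. -/
theorem isDualDerivation_of_delta {D : Beurling hω →L[ℂ] (Beurling hω →L[ℂ] ℂ)}
    (h : ∀ x y z, D (delta hω (x * y)) (delta hω z) =
      D (delta hω y) (delta hω (z * x)) + D (delta hω x) (delta hω (y * z))) :
    IsDualDerivation D := by
  let M := ContinuousLinearMap.mul ℂ (Beurling hω)
  -- Both sides are continuous and linear in each variable separately, so point masses are replaced
  -- by general elements one variable at a time.
  have h1 : ∀ x y c, D (delta hω x * delta hω y) c =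
      D (delta hω y) (c * delta hω x) + D (delta hω x) (delta hω y * c) := fun x y c =>
    DFunLike.congr_fun (clm_ext (S := D (delta hω x * delta hω y))
      (T := (D (delta hω y)).comp (M.flip (delta hω x)) + (D (delta hω x)).comp (M (delta hω y)))
      fun z => by simpa [M, delta_mul_delta] using h x y z) c
  have h2 : ∀ x b c, D (delta hω x * b) c =
      D b (c * delta hω x) + D (delta hω x) (b * c) := fun x b c =>
    DFunLike.congr_fun (clm_ext (S := (D.flip c).comp (M (delta hω x)))
      (T := D.flip (c * delta hω x) + (D (delta hω x)).comp (M.flip c))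
      fun y => by simpa [M] using h1 x y c) b
  exact fun a b c => DFunLike.congr_fun (clm_ext (S := (D.flip c).comp (M.flip b))
    (T := (D b).comp (M c) + D.flip (b * c)) fun x => by simpa [M] using h2 x b c) a

/-! ### Weak amenability over commutative groups -/

/-- For a commutative group, the weak amenability of `ℓ¹(G, ω)` says that no nonzero homomorphism
`G → ℂ` is bounded by a multiple of `ω x * ω x⁻¹`. -/
theorem isWeaklyAmenable_iff_of_comm (hω : IsWeight ω) (hc : ∀ x y : G, x * y = y * x) :
    IsWeaklyAmenable (Beurling hω) ↔
      ∀ φ : G → ℂ, (∀ x y, φ (x * y) = φ x + φ y) → ∀ K : ℝ, 0 ≤ K →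
        (∀ x, ‖φ x‖ ≤ K * (ω x * ω x⁻¹)) → ∀ x, φ x = 0 := by
  classical
  constructor
  · intro hA φ hφ K hK hb x
    obtain ⟨D, hD⟩ := exists_clm_of_kernel hω (fun x y => if x * y = 1 then φ x else 0) hK
      fun x y => by
        have hx := hω.pos x
        have hy := hω.pos y
        split_ifs with h
        · rw [mul_assoc, ← inv_eq_of_mul_eq_one_right h]
          exact hb x
        · rw [norm_zero]
          positivity
    obtain ⟨ψ, hψ⟩ := hA D (isDualDerivation_of_delta fun x y z => by
      simp only [hD]
      rw [show y * (z * x) = x * y * z by rw [← mul_assoc, hc, mul_assoc],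
        ← mul_assoc x y z, hφ]
      split_ifs
      · rw [add_comm]
      · rw [add_zero])
    have h := hψ (delta hω x) (delta hω x⁻¹)
    simpa [hD, delta_mul_delta] using h
  · intro h D hD
    refine ⟨0, fun a b => ?_⟩
    suffices D = 0 by simp [this]
    -- For fixed c, the derivation identity makes this expression additive in x. As c varies, these
    -- pairs cover all of G × G.
    have key : ∀ c x, D (delta hω x) (delta hω (x⁻¹ * c)) = 0 := fun c => by
      refine h _ (fun x y => ?_) (‖D‖ * ω c) (mul_nonneg (norm_nonneg D) (hω.pos c).le)
        fun x => ?_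
      · rw [← delta_mul_delta, hD, delta_mul_delta, delta_mul_delta, add_comm]
        congr 3
        · rw [mul_inv_rev, mul_assoc, mul_inv_cancel_left]
        · rw [hc _ x, mul_inv_rev, hc y⁻¹, mul_assoc, mul_inv_cancel_left]
      · refine (norm_apply_delta_le D _ _).trans ?_
        have h1 := hω.mul_le x⁻¹ c
        calc _ ≤ ‖D‖ * ω x * (ω x⁻¹ * ω c) :=
              mul_le_mul_of_nonneg_left h1 (mul_nonneg (norm_nonneg D) (hω.pos x).le)
          _ = _ := by ring
    refine clm_ext fun x => clm_ext fun y => ?_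
    simpa using key (x * y) x

/-- A homomorphism grows linearly along powers, φ(xⁿ) = n φ(x), so a sublinear bound kills it. -/
theorem eq_zero_of_hom_le (φ : G → ℂ) (hφ : ∀ x y, φ (x * y) = φ x + φ y) (x : G) (u : ℕ → ℝ)
    (hu : Filter.Tendsto (fun n => u n / n) Filter.atTop (nhds 0))
    (hb : ∀ n, ‖φ (x ^ n)‖ ≤ u n) : φ x = 0 := by
  have h1 : φ 1 = 0 := by simpa using hφ 1 1
  have hn : ∀ n : ℕ, φ (x ^ n) = n * φ x := fun n => by
    induction n with
    | zero => simp [h1]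
    | succ n ih => rw [pow_succ, hφ, ih]; push_cast; ring
  refine norm_le_zero_iff.mp (ge_of_tendsto hu ?_)
  filter_upwards [Filter.eventually_gt_atTop 0] with n hn0
  have h := hb n
  rw [hn, norm_mul, Complex.norm_natCast] at h
  rw [le_div_iff₀ (by exact_mod_cast hn0), mul_comm]
  exact h

end Beurling

theorem IsWeight.comp {G H : Type*} [Group G] [Group H] {ω : H → ℝ} (hω : IsWeight ω)
    (f : G →* H) : IsWeight fun x => ω (f x) :=
  ⟨fun x => hω.pos _, fun x y => by rw [map_mul]; exact hω.mul_le _ _⟩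

/-! ### The affine group and its non-inner derivation -/

namespace AxB

/-- The homomorphism `(a, b) ↦ a`. -/
def slope : AxB →* PosReal where
  toFun := AxB.a
  map_one' := rfl
  map_mul' _ _ := rfl

theorem slope_surjective : Function.Surjective slope := fun a => ⟨⟨a, 0⟩, rfl⟩

/-- The quotient by the translations is the multiplicative group of positive reals. -/
def quotientEquiv : AxB ⧸ translations ≃* PosReal :=
  QuotientGroup.quotientKerEquivOfSurjective slope slope_surjective

theorem quotientEquiv_mk (p : AxB) : quotientEquiv (p : AxB ⧸ translations) = p.a := rfl

theorem quotientWeight_eq {w : PosReal → ℝ} {ω : AxB → ℝ} (h : ∀ p : AxB, ω p = w p.a)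
    (q : AxB ⧸ translations) : quotientWeight ω translations q = w (quotientEquiv q) := by
  obtain ⟨p, rfl⟩ := QuotientGroup.mk_surjective q
  have : ω '' {z : AxB | (z : AxB ⧸ translations) = p} = {w p.a} := by
    refine Set.eq_singleton_iff_unique_mem.mpr ⟨⟨p, rfl, h p⟩, ?_⟩
    rintro _ ⟨z, hz, rfl⟩
    have hz' : quotientEquiv (z : AxB ⧸ translations) = quotientEquiv p := congrArg _ hz
    rw [quotientEquiv_mk, quotientEquiv_mk] at hz'
    rw [h, hz']
  rw [quotientWeight, this, csInf_singleton, quotientEquiv_mk]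

/-- The diagonal growth `log (w a * w a⁻¹)` of a weight, placed on the conjugacy class of the
translations `(1, b)` with `0 < b`. -/
def logGrowth (w : PosReal → ℝ) (p : AxB) : ℝ :=
  open scoped Classical in
  if h : p.a = 1 ∧ 0 < p.b then Real.log (w ⟨p.b, h.2⟩ * w ⟨p.b, h.2⟩⁻¹) else 0

theorem logGrowth_mk (w : PosReal → ℝ) (b : PosReal) :
    logGrowth w ⟨1, b⟩ = Real.log (w b * w b⁻¹) := by
  simp [logGrowth, b.2]

theorem logGrowth_of_not (w : PosReal → ℝ) {p : AxB} (h : ¬ (p.a = 1 ∧ 0 < p.b)) :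
    logGrowth w p = 0 := by
  simp only [logGrowth, dif_neg h]

/-- log Ω is subadditive and invariant under inversion, hence Lipschitz under translation; finally
log t ≤ t. -/
theorem abs_log_sub_log_le {w : PosReal → ℝ} (hw : IsWeight w) (a b : PosReal) :
    |Real.log (w (a * b) * w (a * b)⁻¹) - Real.log (w b * w b⁻¹)| ≤ w a * w a⁻¹ := by
  have hpos : ∀ x, 0 < w x * w x⁻¹ := fun x => mul_pos (hw.pos _) (hw.pos _)
  have hle : ∀ x y, Real.log (w (x * y) * w (x * y)⁻¹) ≤
      Real.log (w x * w x⁻¹) + Real.log (w y * w y⁻¹) := fun x y => by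
    rw [← Real.log_mul (hpos x).ne' (hpos y).ne']
    refine Real.log_le_log (hpos _) ?_
    have h1 := hw.mul_le x y
    have h2 := hw.mul_le x⁻¹ y⁻¹
    rw [← mul_inv] at h2
    calc _ ≤ (w x * w y) * (w x⁻¹ * w y⁻¹) :=
          mul_le_mul h1 h2 (hw.pos _).le (mul_pos (hw.pos _) (hw.pos _)).le
      _ = _ := by ring
  have h1 := hle a b
  have h2 := hle a⁻¹ (a * b)
  rw [inv_mul_cancel_left, inv_inv, mul_comm (w a⁻¹)] at h2
  have h3 := Real.log_le_self (hpos a).le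
  rw [abs_le]
  constructor <;> linarith

theorem abs_logGrowth_sub_le {w : PosReal → ℝ} (hw : IsWeight w) (p q : AxB) :
    |logGrowth w (q * p) - logGrowth w (p * q)| ≤ w p.a * w q.a := by
  have hpos : 0 ≤ w p.a * w q.a := (mul_pos (hw.pos _) (hw.pos _)).le
  -- Either both products are translations or neither is, and then both values are 0.
  by_cases ha : q.a = p.a⁻¹
  · have hb : (p * q).b = p.a * (q * p).b := by
      have := p.a.2.ne'
      simp only [mul_b, ha, Positive.coe_inv]
      field_simp
      ring
    by_cases hq : 0 < (q * p).b
    · have e1 : q * p = ⟨1, (⟨(q * p).b, hq⟩ : PosReal)⟩ := AxB.ext (by simp [ha]) rfl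
      have e2 : p * q = ⟨1, (p.a * ⟨(q * p).b, hq⟩ : PosReal)⟩ :=
        AxB.ext (by simp [ha]) (by rw [hb]; rfl)
      have h := abs_log_sub_log_le hw p.a ⟨(q * p).b, hq⟩
      rw [abs_sub_comm, e2]
      nth_rw 2 [e1]
      rw [logGrowth_mk, logGrowth_mk, ha]
      exact h
    -- Slopes are positive, so conjugation preserves the sign of b and both values are again 0.
    · rw [logGrowth_of_not w fun h => hq h.2, logGrowth_of_not w fun h => hq
        (pos_of_mul_pos_right (hb ▸ h.2) p.a.2.le)]
      simpa using hpos
  · rw [logGrowth_of_not w fun h => ha (eq_inv_of_mul_eq_one_left h.1),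
      logGrowth_of_not w fun h => ha (eq_inv_of_mul_eq_one_right h.1)]
    simpa using hpos

/-- If `w` is not diagonally bounded then `ℓ¹(ax+b, ω)`, `ω (a, b) = w a`, is not weakly
amenable. -/
theorem not_isWeaklyAmenable {w : PosReal → ℝ} (hw : IsWeight w) (hd : ¬ DiagonallyBounded w)
    {ω : AxB → ℝ} (hω : IsWeight ω) (h : ∀ p : AxB, ω p = w p.a) :
    ¬ IsWeaklyAmenable (Beurling hω) := by
  intro hA
  obtain ⟨D, hD⟩ := Beurling.exists_clm_of_kernel hω
    (fun p q => ((logGrowth w (q * p) - logGrowth w (p * q) : ℝ) : ℂ)) zero_le_one fun p q => by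
      rw [Complex.norm_real, one_mul, h, h]
      exact abs_logGrowth_sub_le hw p q
  obtain ⟨ψ, hψ⟩ := hA D (Beurling.isDualDerivation_of_delta fun x y z => by
    simp only [hD, mul_assoc]
    push_cast
    ring)
  have key : ∀ b : PosReal, Real.log (w b * w b⁻¹) ≤
      Real.log (w 1 * w 1⁻¹) + 2 * (‖ψ‖ * w 1) := fun b => by
    -- The two orders of multiplication give (1, 1) and (1, b), so log Ω(b) is compared with log
    -- Ω(1).
    have h1 := hψ (Beurling.delta hω ⟨b, 0⟩) (Beurling.delta hω ⟨b⁻¹, 1⟩)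
    have e1 : (⟨b⁻¹, 1⟩ * ⟨b, 0⟩ : AxB) = ⟨1, (1 : PosReal)⟩ := AxB.ext (by simp) (by simp)
    have e2 : (⟨b, 0⟩ * ⟨b⁻¹, 1⟩ : AxB) = ⟨1, b⟩ := AxB.ext (by simp) (by simp)
    rw [hD, Beurling.delta_mul_delta, Beurling.delta_mul_delta, e1, e2, logGrowth_mk,
      logGrowth_mk] at h1
    have h2 : ∀ c : ℝ, ‖ψ (Beurling.delta hω ⟨1, c⟩)‖ ≤ ‖ψ‖ * w 1 := fun c => by
      have := ψ.le_opNorm (Beurling.delta hω ⟨1, c⟩)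
      rwa [Beurling.norm_delta, h] at this
    have h3 := congrArg norm h1
    rw [Complex.norm_real, Real.norm_eq_abs] at h3
    have h4 := norm_sub_le (ψ (Beurling.delta hω ⟨1, ((1 : PosReal) : ℝ)⟩))
      (ψ (Beurling.delta hω ⟨1, b⟩))
    have h5 := (abs_le.mp (h3.le.trans h4)).1
    linarith [h2 b, h2 ((1 : PosReal) : ℝ)]
  refine hd ⟨Real.exp (Real.log (w 1 * w 1⁻¹) + 2 * (‖ψ‖ * w 1)), ?_⟩
  rintro _ ⟨b, rfl⟩
  exact (Real.log_le_iff_le_exp (mul_pos (hw.pos _) (hw.pos _))).mp (key b)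

end AxB

/-! ### The subgroup and the quotient -/

/-- A constant weight on a commutative group gives a weakly amenable algebra. -/
theorem isWeaklyAmenable_of_const {G : Type*} [Group G] {ω : G → ℝ} (hω : IsWeight ω)
    (hc : ∀ x y : G, x * y = y * x) {c : ℝ} (h : ∀ x, ω x = c) :
    IsWeaklyAmenable (Beurling hω) :=
  (Beurling.isWeaklyAmenable_iff_of_comm hω hc).mpr fun φ hφ K _ hb x =>
    Beurling.eq_zero_of_hom_le φ hφ x (fun _ => K * (c * c))
      (tendsto_const_div_atTop_nhds_zero_nat _) fun n => by
        simpa only [h] using hb (x ^ n)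

/-- Weak amenability of `ℓ¹` of a commutative group passes along isomorphisms. -/
theorem isWeaklyAmenable_of_mulEquiv {G H : Type*} [Group G] [CommGroup H] {ω : G → ℝ} {w : H → ℝ}
    (hω : IsWeight ω) (hw : IsWeight w) (e : G ≃* H) (h : ∀ x, ω x = w (e x))
    (hA : IsWeaklyAmenable (Beurling hw)) : IsWeaklyAmenable (Beurling hω) := by
  rw [Beurling.isWeaklyAmenable_iff_of_comm hw mul_comm] at hA
  refine (Beurling.isWeaklyAmenable_iff_of_comm hω fun x y => e.injective ?_).mpr
    fun φ hφ K hK hb x => ?_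
  · rw [map_mul, map_mul, mul_comm]
  · have := hA (fun y => φ (e.symm y)) (fun y z => by rw [map_mul, hφ]) K hK
      (fun y => by simpa [h] using hb (e.symm y)) (e x)
    simpa using this

/-! ### Powers of 1 + |ln a| -/

section LogWeight

variable {α : ℝ}

theorem isWeight_log (hα : 0 < α) : IsWeight fun a : PosReal => (1 + |Real.log a|) ^ α where
  pos x := by positivity
  mul_le x y := by
    rw [← Real.mul_rpow (by positivity) (by positivity)]
    refine Real.rpow_le_rpow (by positivity) ?_ hα.le
    rw [show ((x * y : PosReal) : ℝ) = x * y from rfl, Real.log_mul x.2.ne' y.2.ne']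
    nlinarith [abs_add_le (Real.log x) (Real.log y), abs_nonneg (Real.log x),
      abs_nonneg (Real.log y), mul_nonneg (abs_nonneg (Real.log x)) (abs_nonneg (Real.log y))]

theorem logWeight_mul_inv (a : PosReal) :
    (1 + |Real.log a|) ^ α * (1 + |Real.log (a⁻¹ : PosReal)|) ^ α
      = (1 + |Real.log a|) ^ (2 * α) := by
  rw [Positive.coe_inv, Real.log_inv, abs_neg, ← Real.rpow_add (by positivity), two_mul]

theorem not_diagonallyBounded_log (hα : 0 < α) :
    ¬ DiagonallyBounded (fun a : PosReal => (1 + |Real.log a|) ^ α) := by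
  rintro ⟨C, hC⟩
  have ht : Filter.Tendsto (fun t : ℝ => (1 + t) ^ (2 * α)) Filter.atTop Filter.atTop :=
    (tendsto_rpow_atTop (by positivity)).comp
      (Filter.tendsto_atTop_add_const_left _ 1 Filter.tendsto_id)
  obtain ⟨t, h1, h2⟩ :=
    ((ht.eventually_gt_atTop C).and (Filter.eventually_ge_atTop 0)).exists
  have h := hC ⟨⟨Real.exp t, Real.exp_pos t⟩, rfl⟩
  beta_reduce at h
  rw [logWeight_mul_inv, Real.log_exp, abs_of_nonneg h2] at h
  linarith

/-- This is where α < 1/2 enters: Ω has exponent 2α < 1, so it grows sublinearly along powers. The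
comparison uses 1 + nc ≤ (1 + c) n for n ≥ 1. -/
theorem tendsto_logWeight_div (hα : 0 < α) (hα' : α < 1 / 2) (K c : ℝ) (hc : 0 ≤ c) :
    Filter.Tendsto (fun n : ℕ => K * (1 + n * c) ^ (2 * α) / n) Filter.atTop (nhds 0) := by
  have h1 : Filter.Tendsto (fun n : ℕ => |K| * (1 + c) ^ (2 * α) * (n : ℝ) ^ (-(1 - 2 * α)))
      Filter.atTop (nhds 0) := by
    have h : Filter.Tendsto (fun t : ℝ => t ^ (-(1 - 2 * α))) Filter.atTop (nhds 0) :=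
      tendsto_rpow_neg_atTop (by linarith)
    have h' := (h.comp (tendsto_natCast_atTop_atTop (R := ℝ))).const_mul (|K| * (1 + c) ^ (2 * α))
    rwa [mul_zero] at h'
  refine squeeze_zero_norm' ?_ h1
  filter_upwards [Filter.eventually_gt_atTop 0] with n hn
  have hn1 : (1 : ℝ) ≤ n := by exact_mod_cast hn
  have hn0 : (0 : ℝ) < n := by linarith
  rw [norm_div, norm_mul, Real.norm_eq_abs, Real.norm_natCast,
    Real.norm_of_nonneg (Real.rpow_nonneg (by positivity) _), div_le_iff₀ hn0]
  have h2 : (1 + n * c) ^ (2 * α) ≤ (1 + c) ^ (2 * α) * (n : ℝ) ^ (2 * α) := by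
    rw [← Real.mul_rpow (by positivity) hn0.le]
    exact Real.rpow_le_rpow (by positivity) (by nlinarith) (by linarith)
  have h3 : (n : ℝ) ^ (-(1 - 2 * α)) * n = (n : ℝ) ^ (2 * α) := by
    rw [← Real.rpow_add_one hn0.ne']
    congr 1
    ring
  rw [mul_assoc, h3, mul_assoc]
  exact mul_le_mul_of_nonneg_left h2 (abs_nonneg K)

theorem isWeaklyAmenable_log (hα : 0 < α) (hα' : α < 1 / 2) :
    IsWeaklyAmenable (Beurling (isWeight_log hα)) :=
  (Beurling.isWeaklyAmenable_iff_of_comm _ mul_comm).mpr fun φ hφ K _ hb x =>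
    Beurling.eq_zero_of_hom_le φ hφ x (fun n => K * (1 + n * |Real.log x|) ^ (2 * α))
      (tendsto_logWeight_div hα hα' K _ (abs_nonneg _)) fun n => by
        have h := hb (x ^ n)
        rw [logWeight_mul_inv, show ((x ^ n : PosReal) : ℝ) = (x : ℝ) ^ n from rfl, Real.log_pow,
          abs_mul, Nat.abs_cast] at h
        exact h

end LogWeight

end

/-! ### Assembly -/

theorem mainTheorem11 :
    (∀ (w : PosReal → ℝ) (hw : IsWeight w),
      ¬ DiagonallyBounded w → IsWeaklyAmenable (Beurling hw) →
      ∀ ω : AxB → ℝ, (∀ p : AxB, ω p = w p.a) →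
        (∀ h : AxB.translations, ω h = w 1) ∧
        (∀ p : AxB, quotientWeight ω AxB.translations (p : AxB ⧸ AxB.translations) = w p.a) ∧
        ¬ DiagonallyBounded ω ∧
        ∃ (hω : IsWeight ω)
          (hωH : IsWeight fun h : AxB.translations => ω h)
          (hωq : IsWeight (quotientWeight ω AxB.translations)),
          IsWeaklyAmenable (Beurling hωH) ∧
          IsWeaklyAmenable (Beurling hωq) ∧
          ¬ IsWeaklyAmenable (Beurling hω)) ∧
    (∀ α : ℝ, 0 < α → α < 1 / 2 →
      ¬ DiagonallyBounded (fun a : PosReal => (1 + |Real.log a|) ^ α) ∧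
      ∃ hw : IsWeight (fun a : PosReal => (1 + |Real.log a|) ^ α),
        IsWeaklyAmenable (Beurling hw)) := by
  refine ⟨fun w hw hd hA ω h => ?_, fun α hα hα' =>
    ⟨not_diagonallyBounded_log hα, isWeight_log hα, isWeaklyAmenable_log hα hα'⟩⟩
  have hω : IsWeight ω := by
    rw [show ω = fun p => w (AxB.slope p) from funext h]
    exact hw.comp AxB.slope
  have hωH : IsWeight fun h : AxB.translations => ω h := hω.comp AxB.translations.subtype
  have hωq : IsWeight (quotientWeight ω AxB.translations) := by
    rw [show quotientWeight ω AxB.translations = _ from funext (AxB.quotientWeight_eq h)]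
    exact hw.comp AxB.quotientEquiv.toMonoidHom
  have hH : ∀ x : AxB.translations, ω x = w 1 := fun x => by
    rw [h, show (x : AxB).a = 1 from x.2]
  refine ⟨hH, fun p => AxB.quotientWeight_eq h p, ?_, hω, hωH, hωq,
    isWeaklyAmenable_of_const hωH (fun x y => ?_) hH,
    isWeaklyAmenable_of_mulEquiv hωq hw AxB.quotientEquiv (AxB.quotientWeight_eq h) hA,
    AxB.not_isWeaklyAmenable hw hd hω h⟩
  · rintro ⟨C, hC⟩
    refine hd ⟨C, ?_⟩
    rintro _ ⟨a, rfl⟩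
    have := hC ⟨(⟨a, 0⟩ : AxB), rfl⟩
    simpa only [h, AxB.inv_a] using this
  · have hx : (x : AxB).a = 1 := x.2
    have hy : (y : AxB).a = 1 := y.2
    exact Subtype.ext (AxB.ext (by simp [hx, hy]) (by simp [hx, hy, add_comm]))
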